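/- Let $\mathbb N=\{1,2,3,\dots\}$. Let $\mathcal N=\{n_1,n_2,\dots\}$ and $\mathcal M=\{m_1,m_2,\dots\}$ be disjoint, recursively inseparable subsets of $\mathbb N$ (no recursive $T\subseteq\mathbb N$ satisfies $\mathcal N\subseteq T$ and $\mathcal M\subseteq\mathbb N\setminus T$), enumerated without repetitions by computable maps $i\mapsto n_i$ and $i\mapsto m_i$. For $n\in\mathbb N$ let $\dot A_n$ be the abelian group generated by $\dot a_{n,0},\dot a_{n,1}$ subject to $\dot a_{n,1}=2^i\dot a_{n,0}$ if $n=n_i\in\mathcal N$, to $\dot a_{n,1}=3^i\dot a_{n,0}$ if $n=m_i\in\mathcal M$, and to no relation (so that it is free abelian of rank $2$) if $n\notin\mathcal N\cup\mathcal M$. Let $\dot B_n$ be the abelian group generated by $\dot b_{n,0},\dot b_{n,1}$ subject to $\dot b_{n,1}=2^i\dot b_{n,0}$ if $n=n_i\in\mathcal N$ or $n=m_i\in\mathcal M$, and to no relation if $n\notin\mathcal N\cup\mathcal M$. Let $$\dot G=\Big(\big(*_{n=1}^\infty\dot A_n\big)*\big(*_{n=1}^\infty\dot B_n\big)*F(t_1,t_2,\dots)\Big)\Big/\big\langle\!\big\langle\,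 t_i^{-1}\dot a_{n_i,0}\,t_i=\dot b_{n_i,0}\ (i\in\mathbb N)\,\big\rangle\!\big\rangle .$$ Let $\ddot G$ be a finitely generated torsion-free group with decidable word problem and let $\Phi:\dot G\to\ddot G$ be an injective homomorphism such that the maps $(n,m)\mapsto\Phi(\dot a_{n,m})$, $(n,m)\mapsto\Phi(\dot b_{n,m})$ and $n\mapsto\Phi(t_n)$, for $n\in\mathbb N$ and $m\in\{0,1\}$, are computable (some algorithm outputs, for each argument, a word in a fixed finite generating set of $\ddot G$ that represents the value). Then $\ddot G$ does not embed into any group with decidable conjugacy problem, that is, into any group $\bar G$ that has a finite or countable, effectively enumerated generating family for which some algorithm decides whether two given words in the generators and their inverses represent conjugate elements of $\bar G$. -/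

import Mathlib

namespace DotGroup

/-! ### Computability -/

/-- Two disjoint sets that no recursive set separates. -/
def RecursivelyInseparable (S₁ S₂ : Set ℕ+) : Prop :=
  Disjoint S₁ S₂ ∧ ¬ ∃ T : Set ℕ+, ComputablePred (fun n => n ∈ T) ∧ S₁ ⊆ T ∧ S₂ ⊆ Tᶜ

/-- Group words in letters `ι`: `(i, true)` is the letter of index `i`, `(i, false)` its formal
inverse. -/
abbrev Word (ι : Type) : Type := List (ι × Bool)

/-- The element of `G` which a word represents, when the letter `i` stands for `x i`. -/
def wordVal {ι : Type} {G : Type*} [Group G] (x : ι → G) (w : Word ι) : G :=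
  FreeGroup.lift x (FreeGroup.mk w)

/-- There is an algorithm which decides whether two words represent the same element. -/
def WordProblemDecidable {ι : Type} [Primcodable ι] {G : Type*} [Group G] (x : ι → G) : Prop :=
  ComputablePred (fun p : Word ι × Word ι => wordVal x p.1 = wordVal x p.2)

/-- There is an algorithm which decides whether two words represent conjugate elements. -/
def ConjugacyProblemDecidable {ι : Type} [Primcodable ι] {G : Type*} [Group G]
    (x : ι → G) : Prop :=
  ComputablePred (fun p : Word ι × Word ι => IsConj (wordVal x p.1) (wordVal x p.2))

/-- `G` has decidable conjugacy problem: `G` is generated by a finite or countable, effectively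
listed family of elements (`G` need not be finitely generated), and conjugacy of words in these
generators is decidable. (A word is conjugate to the empty word if and only if it represents `1`,
so the words representing `1` then form a decidable set of defining relators of `G`.) -/
def HasDecidableConjugacyProblem (G : Type*) [Group G] : Prop :=
  ∃ (ι : Type) (_ : Primcodable ι) (x : ι → G),
    Subgroup.closure (Set.range x) = ⊤ ∧ ConjugacyProblemDecidable x

/-- The map `φ : α → G` is computable with respect to the generators `x`: an algorithm returns,
for each `a`, a word which represents `φ a`. -/
def ComputableInto {ι : Type} [Primcodable ι] {G : Type*} [Group G] (x : ι → G)
    {α : Type} [Primcodable α] (φ : α → G) : Prop :=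
  ∃ f : α → Word ι, Computable f ∧ ∀ a, wordVal x (f a) = φ a

/-- Every element of finite order is trivial. -/
def TorsionFree (G : Type*) [Group G] : Prop := ∀ g : G, IsOfFinOrder g → g = 1

/-! ### The group `Ġ`

Throughout `ν i = n_i` and `μ i = m_i`, for `i = 1, 2, 3, …`. -/

/-- The basis of the free abelian group `ℤ × ℤ`. -/
def basisVec (m : Fin 2) : ℤ × ℤ := if m = 0 then (1, 0) else (0, 1)

/-- The relators of `Ȧ_n`, namely `a_{n,1} - 2 ^ i a_{n,0}` if `n = n_i` and
`a_{n,1} - 3 ^ i a_{n,0}` if `n = m_i`; there are none for the other `n`. -/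
def relA (ν μ : ℕ+ → ℕ+) (n : ℕ+) : Set (ℤ × ℤ) :=
  {r | ∃ i, ν i = n ∧ r = basisVec 1 - (2 : ℤ) ^ (i : ℕ) • basisVec 0} ∪
  {r | ∃ i, μ i = n ∧ r = basisVec 1 - (3 : ℤ) ^ (i : ℕ) • basisVec 0}

/-- The relators of `Ḃ_n`, namely `b_{n,1} - 2 ^ i b_{n,0}` if `n = n_i` or `n = m_i`; there are
none for the other `n`. -/
def relB (ν μ : ℕ+ → ℕ+) (n : ℕ+) : Set (ℤ × ℤ) :=
  {r | ∃ i, (ν i = n ∨ μ i = n) ∧ r = basisVec 1 - (2 : ℤ) ^ (i : ℕ) • basisVec 0}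

/-- The abelian group `Ȧ_n`, written multiplicatively. -/
def ADot (ν μ : ℕ+ → ℕ+) (n : ℕ+) : Type :=
  Multiplicative ((ℤ × ℤ) ⧸ AddSubgroup.closure (relA ν μ n))

instance (ν μ : ℕ+ → ℕ+) (n : ℕ+) : CommGroup (ADot ν μ n) :=
  inferInstanceAs (CommGroup (Multiplicative ((ℤ × ℤ) ⧸ AddSubgroup.closure (relA ν μ n))))

/-- The abelian group `Ḃ_n`, written multiplicatively. -/
def BDot (ν μ : ℕ+ → ℕ+) (n : ℕ+) : Type :=
  Multiplicative ((ℤ × ℤ) ⧸ AddSubgroup.closure (relB ν μ n))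

instance (ν μ : ℕ+ → ℕ+) (n : ℕ+) : CommGroup (BDot ν μ n) :=
  inferInstanceAs (CommGroup (Multiplicative ((ℤ × ℤ) ⧸ AddSubgroup.closure (relB ν μ n))))

/-- The image `ȧ_{n,m}` of the basis vector in `Ȧ_n`. -/
def genA (ν μ : ℕ+ → ℕ+) (n : ℕ+) (m : Fin 2) : ADot ν μ n :=
  Multiplicative.ofAdd (QuotientAddGroup.mk (basisVec m))

/-- The image `ḃ_{n,m}` of the basis vector in `Ḃ_n`. -/
def genB (ν μ : ℕ+ → ℕ+) (n : ℕ+) (m : Fin 2) : BDot ν μ n :=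
  Multiplicative.ofAdd (QuotientAddGroup.mk (basisVec m))

/-- The free product of all `Ȧ_n`, all `Ḃ_n` and the free group on `t_1, t_2, …`. -/
def FreeProd (ν μ : ℕ+ → ℕ+) : Type :=
  Monoid.Coprod (Monoid.Coprod (Monoid.CoprodI (ADot ν μ)) (Monoid.CoprodI (BDot ν μ)))
    (FreeGroup ℕ+)

instance (ν μ : ℕ+ → ℕ+) : Group (FreeProd ν μ) :=
  inferInstanceAs (Group (Monoid.Coprod
    (Monoid.Coprod (Monoid.CoprodI (ADot ν μ)) (Monoid.CoprodI (BDot ν μ))) (FreeGroup ℕ+)))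

/-- The inclusion of `Ȧ_n` into the free product. -/
def inclA (ν μ : ℕ+ → ℕ+) (n : ℕ+) : ADot ν μ n →* FreeProd ν μ :=
  Monoid.Coprod.inl.comp (Monoid.Coprod.inl.comp (Monoid.CoprodI.of (M := ADot ν μ) (i := n)))

/-- The inclusion of `Ḃ_n` into the free product. -/
def inclB (ν μ : ℕ+ → ℕ+) (n : ℕ+) : BDot ν μ n →* FreeProd ν μ :=
  Monoid.Coprod.inl.comp (Monoid.Coprod.inr.comp (Monoid.CoprodI.of (M := BDot ν μ) (i := n)))

/-- The inclusion of the free group on `t_1, t_2, …` into the free product. -/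
def inclT (ν μ : ℕ+ → ℕ+) : FreeGroup ℕ+ →* FreeProd ν μ :=
  Monoid.Coprod.inr

/-- `ȧ_{n,m}` in the free product. -/
def preA (ν μ : ℕ+ → ℕ+) (n : ℕ+) (m : Fin 2) : FreeProd ν μ := inclA ν μ n (genA ν μ n m)

/-- `ḃ_{n,m}` in the free product. -/
def preB (ν μ : ℕ+ → ℕ+) (n : ℕ+) (m : Fin 2) : FreeProd ν μ := inclB ν μ n (genB ν μ n m)

/-- `t_i` in the free product. -/
def preT (ν μ : ℕ+ → ℕ+) (i : ℕ+) : FreeProd ν μ := inclT ν μ (FreeGroup.of i)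

/-- The relators expressing `t_i⁻¹ a_{n_i,0} t_i = b_{n_i,0}`. -/
def relT (ν μ : ℕ+ → ℕ+) : Set (FreeProd ν μ) :=
  Set.range fun i : ℕ+ =>
    (preT ν μ i)⁻¹ * preA ν μ (ν i) 0 * preT ν μ i * (preB ν μ (ν i) 0)⁻¹

/-- The group `Ġ`. -/
abbrev GDot (ν μ : ℕ+ → ℕ+) : Type :=
  FreeProd ν μ ⧸ Subgroup.normalClosure (relT ν μ)

/-- The element `ȧ_{n,m}` of `Ġ`. -/
def aDot (ν μ : ℕ+ → ℕ+) (n : ℕ+) (m : Fin 2) : GDot ν μ := QuotientGroup.mk (preA ν μ n m)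

/-- The element `ḃ_{n,m}` of `Ġ`. -/
def bDot (ν μ : ℕ+ → ℕ+) (n : ℕ+) (m : Fin 2) : GDot ν μ := QuotientGroup.mk (preB ν μ n m)

/-- The element `t_i` of `Ġ`. -/
def tDot (ν μ : ℕ+ → ℕ+) (i : ℕ+) : GDot ν μ := QuotientGroup.mk (preT ν μ i)

end DotGroup

namespace DotGroup

/-! ### Computability of word operations -/

section Words

variable {ι κ : Type} {G H : Type*} [Group G] [Group H]

/-! Suppose `Gdd` embeds in a group `Gbar` with decidable conjugacy problem. For each `n` one can
then decide whether the images of `a_{n,0}` and `b_{n,0}` are conjugate in `Gbar` and, if they are,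
find a conjugator `C n` by search, because the word problem of `Gbar` is decidable too. Let `T` be
the set of those `n` for which `C n` conjugates both `a_{n,0}` to `b_{n,0}` and `a_{n,1}` to
`b_{n,1}`; it is recursive.

If `n = n_i`, then `t_i` makes the first pair conjugate, and every conjugator of the first pair also
serves the second, since `a_{n,1}` and `b_{n,1}` are the same power `2 ^ i` of `a_{n,0}` and
`b_{n,0}`. So `n ∈ T`. If `n = m_i`, a common conjugator would give `b_{n,0} ^ 3 ^ i = b_{n,0} ^ 2 ^
i`, which is impossible because `b_{n,0}` has infinite order (`bDot_zero_zpow_injective`). So `T`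
would separate the two sets.

The effective part rests on `ComputableInto.map` and `exists_computable_choice`. -/

theorem wordVal_append (x : ι → G) (u v : Word ι) :
    wordVal x (u ++ v) = wordVal x u * wordVal x v := by
  simp [wordVal, ← FreeGroup.mul_mk]

@[simp]
theorem wordVal_nil (x : ι → G) : wordVal x [] = 1 := by
  simp [wordVal, ← FreeGroup.one_eq_mk]

theorem wordVal_cons (x : ι → G) (l : ι × Bool) (w : Word ι) :
    wordVal x (l :: w) = wordVal x [l] * wordVal x w := by
  rw [← wordVal_append, List.singleton_append]

theorem wordVal_invRev (x : ι → G) (w : Word ι) :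
    wordVal x (FreeGroup.invRev w) = (wordVal x w)⁻¹ := by
  simp [wordVal, ← FreeGroup.inv_mk]

theorem exists_wordVal_eq {x : ι → G} (hx : Subgroup.closure (Set.range x) = ⊤) (g : G) :
    ∃ w : Word ι, wordVal x w = g := by
  have hg : g ∈ (FreeGroup.lift x).range := by
    rw [FreeGroup.range_lift_eq_closure, hx]
    trivial
  obtain ⟨v, rfl⟩ := hg
  obtain ⟨w, rfl⟩ := Quot.exists_rep v
  exact ⟨w, rfl⟩

/-- Substituting words for letters computes the image of a word under a homomorphism. -/
theorem wordVal_flatMap (s : κ → G) (x : ι → H) (Ψ : G →* H) (W : κ × Bool → Word ι)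
    (hW : ∀ l, wordVal x (W l) = Ψ (wordVal s [l])) (w : Word κ) :
    wordVal x (w.flatMap W) = Ψ (wordVal s w) := by
  induction w with
  | nil => simp
  | cons l w ih => rw [List.flatMap_cons, wordVal_append, ih, hW, wordVal_cons s l w, map_mul]

theorem primrec_invRev [Primcodable ι] : Primrec (FreeGroup.invRev : Word ι → Word ι) := by
  unfold FreeGroup.invRev
  exact Primrec.list_reverse.comp <| Primrec.list_map Primrec.id
    ((Primrec.pair Primrec.fst (Primrec.not.comp Primrec.snd)).comp Primrec.snd).to₂

theorem _root_.ComputablePred.preimage {α β : Type*} [Primcodable α] [Primcodable β] {p : β → Prop}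
    (hp : ComputablePred p) {f : α → β} (hf : Computable f) : ComputablePred fun a => p (f a) := by
  obtain ⟨q, hq, rfl⟩ := ComputablePred.computable_iff.1 hp
  exact ComputablePred.computable_iff.2 ⟨_, hq.comp hf, rfl⟩

/-- A word is trivial if and only if it represents a conjugate of the identity. -/
theorem ConjugacyProblemDecidable.wordProblemDecidable [Primcodable ι] {x : ι → G}
    (h : ConjugacyProblemDecidable x) : WordProblemDecidable x := by
  have hf : Computable fun p : Word ι × Word ι => (p.1 ++ FreeGroup.invRev p.2, ([] : Word ι)) :=
    Computable.pair (Computable.list_append.comp Computable.fst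
      (primrec_invRev.to_comp.comp Computable.snd)) (Computable.const _)
  refine (h.preimage hf).of_eq fun p => ?_
  simp [wordVal_append, wordVal_invRev, mul_inv_eq_one]

/-- Computability into a finitely generated group is preserved by homomorphisms. -/
theorem ComputableInto.map [Primcodable ι] [Primcodable κ] [Finite κ] {s : κ → G} {x : ι → H}
    (hx : Subgroup.closure (Set.range x) = ⊤) (Ψ : G →* H) {α : Type} [Primcodable α] {φ : α → G}
    (hφ : ComputableInto s φ) : ComputableInto x fun a => Ψ (φ a) := by
  obtain ⟨f, hf, hfφ⟩ := hφ
  -- Nothing effective is known about `Ψ`, but there are only finitely many letters, so any choice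
  -- of their image words is a finite table and hence computable.
  choose W hW using fun l : κ × Bool => exists_wordVal_eq hx (Ψ (wordVal s [l]))
  refine ⟨fun a => (f a).flatMap W, ?_, fun a => ?_⟩
  · exact (Primrec.list_flatMap Primrec.id
      ((Primrec.dom_finite W).comp Primrec.snd).to₂).to_comp.comp hf
  · rw [wordVal_flatMap s x Ψ W hW, hfφ]

end Words

/-- A computable function picks a witness of a decidable relation whenever a decidable condition
guarantees that there is one. -/
theorem exists_computable_choice {α β : Type*} [Primcodable α] [Primcodable β] [Inhabited β]
    {Q : α → Prop} {R : α → β → Prop} (hQ : ComputablePred Q)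
    (hR : ComputablePred fun p : α × β => R p.1 p.2) (h : ∀ a, Q a → ∃ b, R a b) :
    ∃ f : α → β, Computable f ∧ ∀ a, Q a → R a (f a) := by
  classical
  obtain ⟨q, hq, rfl⟩ := ComputablePred.computable_iff.1 hQ
  obtain ⟨r, hr, hr'⟩ := ComputablePred.computable_iff.1 hR
  have hR' : ∀ a b, R a b ↔ r (a, b) = true := fun a b => iff_of_eq (congrFun hr' (a, b))
  let dec : ℕ → β := fun n => (Encodable.decode (α := β) n).getD default
  have hdec : Computable dec :=
    Computable.option_getD Computable.decode (Computable.const default)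
  -- The condition is vacuous where `Q` fails, so the unbounded search halts for every `a` and
  -- yields a total function.
  let P : α → ℕ → Prop := fun a n => (!q a || r (a, dec n)) = true
  have hP : ComputablePred fun p : α × ℕ => P p.1 p.2 := by
    refine ComputablePred.computable_iff.2 ⟨_, ?_, rfl⟩
    exact Primrec.or.to_comp.comp
      (Primrec.not.to_comp.comp (hq.comp Computable.fst))
      (hr.comp (Computable.pair Computable.fst (hdec.comp Computable.snd)))
  have hex : ∀ a, ∃ n, P a n := fun a => by
    by_cases ha : q a = true
    · obtain ⟨b, hb⟩ := h a ha
      exact ⟨Encodable.encode b, by simp [P, dec, (hR' a b).1 hb]⟩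
    · exact ⟨0, by simp [P, ha]⟩
  obtain ⟨g, hg, hgP⟩ : ∃ g : α → ℕ, Computable g ∧ ∀ a, P a (g a) :=
    ⟨_, Computable.find hP hex, fun a => Nat.find_spec (hex a)⟩
  refine ⟨fun a => dec (g a), hdec.comp hg, fun a ha => (hR' _ _).2 ?_⟩
  have hga := hgP a
  simp only [P, Bool.or_eq_true, Bool.not_eq_true'] at hga
  exact hga.resolve_left (by rw [show q a = true from ha]; decide)

/-! ### Relations in `Ġ` -/

section Relations

variable {ν μ : ℕ+ → ℕ+}

/-- If `e₁ - c e₀` is a relator then `e₁ = c e₀` in the quotient of `ℤ × ℤ`. -/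
theorem mk_basisVec_one {S : Set (ℤ × ℤ)} {c : ℤ} (h : basisVec 1 - c • basisVec 0 ∈ S) :
    (Multiplicative.ofAdd (QuotientAddGroup.mk (basisVec 1)) :
        Multiplicative ((ℤ × ℤ) ⧸ AddSubgroup.closure S)) =
      Multiplicative.ofAdd (QuotientAddGroup.mk (basisVec 0)) ^ c := by
  rw [← ofAdd_zsmul, ← QuotientAddGroup.mk_zsmul]
  refine congrArg _ (Eq.symm (QuotientAddGroup.eq.2 ?_))
  rw [neg_add_eq_sub]
  exact AddSubgroup.subset_closure h

theorem aDot_one_of_genA {n : ℕ+} {c : ℤ} (h : genA ν μ n 1 = genA ν μ n 0 ^ c) :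
    aDot ν μ n 1 = aDot ν μ n 0 ^ c := by
  rw [aDot, preA, h, map_zpow, QuotientGroup.mk_zpow]
  rfl

theorem bDot_one_of_genB {n : ℕ+} {c : ℤ} (h : genB ν μ n 1 = genB ν μ n 0 ^ c) :
    bDot ν μ n 1 = bDot ν μ n 0 ^ c := by
  rw [bDot, preB, h, map_zpow, QuotientGroup.mk_zpow]
  rfl

theorem aDot_one_left (i : ℕ+) :
    aDot ν μ (ν i) 1 = aDot ν μ (ν i) 0 ^ (2 ^ (i : ℕ) : ℤ) :=
  aDot_one_of_genA (mk_basisVec_one (Or.inl ⟨i, rfl, rfl⟩))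

theorem aDot_one_right (i : ℕ+) :
    aDot ν μ (μ i) 1 = aDot ν μ (μ i) 0 ^ (3 ^ (i : ℕ) : ℤ) :=
  aDot_one_of_genA (mk_basisVec_one (Or.inr ⟨i, rfl, rfl⟩))

theorem bDot_one {i n : ℕ+} (h : ν i = n ∨ μ i = n) :
    bDot ν μ n 1 = bDot ν μ n 0 ^ (2 ^ (i : ℕ) : ℤ) :=
  bDot_one_of_genB (mk_basisVec_one ⟨i, h, rfl⟩)

theorem tDot_conj (i : ℕ+) :
    (tDot ν μ i)⁻¹ * aDot ν μ (ν i) 0 * tDot ν μ i = bDot ν μ (ν i) 0 := by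
  rw [← mul_inv_eq_one]
  exact (QuotientGroup.eq_one_iff _).2 (Subgroup.subset_normalClosure ⟨i, rfl⟩)

end Relations

/-! ### The elements `b_{n,0}` have infinite order -/

section InfiniteOrder

/-- The homomorphism from `(ℤ × ℤ) ⧸ ⟨S⟩` to `ℤ` which sends `e₀` to `1` and `e₁` to `c`. -/
def quotToInt (S : Set (ℤ × ℤ)) (c : ℤ) (h : ∀ r ∈ S, r = basisVec 1 - c • basisVec 0) :
    Multiplicative ((ℤ × ℤ) ⧸ AddSubgroup.closure S) →* Multiplicative ℤ :=
  AddMonoidHom.toMultiplicative <| QuotientAddGroup.lift (AddSubgroup.closure S)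
    (AddMonoidHom.coprod (AddMonoidHom.id ℤ) (AddMonoidHom.mulLeft c)) <| by
      rw [AddSubgroup.closure_le]
      intro r hr
      simp [h r hr, basisVec, AddMonoidHom.mem_ker]

theorem quotToInt_basisVec_zero (S : Set (ℤ × ℤ)) (c : ℤ)
    (h : ∀ r ∈ S, r = basisVec 1 - c • basisVec 0) :
    quotToInt S c h (Multiplicative.ofAdd (QuotientAddGroup.mk (basisVec 0))) =
      Multiplicative.ofAdd 1 := by
  simp [quotToInt, basisVec]

variable {ν μ : ℕ+ → ℕ+}

/-- Injectivity and disjointness leave at most one relator for each `n`. This is what lets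
`quotToInt` be defined on `ADot ν μ n`. -/
theorem exists_relA_eq (hν : Function.Injective ν) (hμ : Function.Injective μ)
    (hd : Disjoint (Set.range ν) (Set.range μ)) (n : ℕ+) :
    ∃ c : ℤ, ∀ r ∈ relA ν μ n, r = basisVec 1 - c • basisVec 0 := by
  by_cases h₁ : ∃ i, ν i = n
  · obtain ⟨i, rfl⟩ := h₁
    refine ⟨2 ^ (i : ℕ), ?_⟩
    rintro r (⟨j, hj, rfl⟩ | ⟨j, hj, rfl⟩)
    · rw [hν hj]
    · exact (Set.disjoint_left.1 hd ⟨i, rfl⟩ ⟨j, hj⟩).elim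
  by_cases h₂ : ∃ i, μ i = n
  · obtain ⟨i, rfl⟩ := h₂
    refine ⟨3 ^ (i : ℕ), ?_⟩
    rintro r (⟨j, hj, rfl⟩ | ⟨j, hj, rfl⟩)
    · exact (h₁ ⟨j, hj⟩).elim
    · rw [hμ hj]
  -- There is no relator here, so any constant would do.
  refine ⟨0, ?_⟩
  rintro r (⟨j, hj, rfl⟩ | ⟨j, hj, rfl⟩)
  exacts [(h₁ ⟨j, hj⟩).elim, (h₂ ⟨j, hj⟩).elim]

theorem exists_relB_eq (hν : Function.Injective ν) (hμ : Function.Injective μ)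
    (hd : Disjoint (Set.range ν) (Set.range μ)) (n : ℕ+) :
    ∃ c : ℤ, ∀ r ∈ relB ν μ n, r = basisVec 1 - c • basisVec 0 := by
  by_cases h : ∃ i, ν i = n ∨ μ i = n
  · obtain ⟨i, hi⟩ := h
    refine ⟨2 ^ (i : ℕ), ?_⟩
    rintro r ⟨j, hj, rfl⟩
    suffices i = j by rw [this]
    rcases hi with rfl | rfl <;> rcases hj with hj | hj
    · exact hν hj.symm
    · exact (Set.disjoint_left.1 hd ⟨i, rfl⟩ ⟨j, hj⟩).elim
    · exact (Set.disjoint_left.1 hd ⟨j, hj⟩ ⟨i, rfl⟩).elim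
    · exact hμ hj.symm
  · refine ⟨0, ?_⟩
    rintro r ⟨j, hj, rfl⟩
    exact (h ⟨j, hj⟩).elim

/-- There is a homomorphism from `Ġ` to `ℤ` which sends all `b_{n,0}` to `1`. -/
theorem exists_hom_bDot_zero (hν : Function.Injective ν) (hμ : Function.Injective μ)
    (hd : Disjoint (Set.range ν) (Set.range μ)) :
    ∃ θ : GDot ν μ →* Multiplicative ℤ, ∀ n, θ (bDot ν μ n 0) = Multiplicative.ofAdd 1 := by
  choose c hc using exists_relA_eq hν hμ hd
  choose d hdB using exists_relB_eq hν hμ hd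
  let fA : Monoid.CoprodI (ADot ν μ) →* Multiplicative ℤ :=
    Monoid.CoprodI.lift fun n => quotToInt (relA ν μ n) (c n) (hc n)
  let fB : Monoid.CoprodI (BDot ν μ) →* Multiplicative ℤ :=
    Monoid.CoprodI.lift fun n => quotToInt (relB ν μ n) (d n) (hdB n)
  -- Every `t_i` goes to the identity. As the target is commutative and `a_{n,0}`, `b_{n,0}` have
  -- the same image, the conjugation relators are killed.
  let f : FreeProd ν μ →* Multiplicative ℤ :=
    Monoid.Coprod.lift (Monoid.Coprod.lift fA fB) 1
  have hfA : ∀ n, f (preA ν μ n 0) = Multiplicative.ofAdd 1 := fun n => by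
    refine Eq.trans ?_ (quotToInt_basisVec_zero (relA ν μ n) (c n) (hc n))
    exact Monoid.CoprodI.lift_of (fun n => quotToInt (relA ν μ n) (c n) (hc n)) (genA ν μ n 0)
  have hfB : ∀ n, f (preB ν μ n 0) = Multiplicative.ofAdd 1 := fun n => by
    refine Eq.trans ?_ (quotToInt_basisVec_zero (relB ν μ n) (d n) (hdB n))
    exact Monoid.CoprodI.lift_of (fun n => quotToInt (relB ν μ n) (d n) (hdB n)) (genB ν μ n 0)
  have hker : Subgroup.normalClosure (relT ν μ) ≤ f.ker := by
    refine Subgroup.normalClosure_le_normal ?_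
    rintro _ ⟨i, rfl⟩
    simp only [SetLike.mem_coe, MonoidHom.mem_ker, map_mul, map_inv, hfA, hfB]
    simp [mul_comm]
  exact ⟨QuotientGroup.lift _ f hker, hfB⟩

theorem bDot_zero_zpow_injective (hν : Function.Injective ν) (hμ : Function.Injective μ)
    (hd : Disjoint (Set.range ν) (Set.range μ)) (n : ℕ+) :
    Function.Injective fun z : ℤ => bDot ν μ n 0 ^ z := by
  obtain ⟨θ, hθ⟩ := exists_hom_bDot_zero hν hμ hd
  intro y z h
  have h' := congrArg (fun g => (θ g).toAdd) h
  simpa [hθ] using h'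

end InfiniteOrder

end DotGroup

/-! ### The recursive separating set -/

theorem lemma13
    -- the computable enumerations, without repetitions, of two recursively inseparable sets
    (ν μ : ℕ+ → ℕ+) (hν : Computable ν) (hμ : Computable μ)
    (hνinj : Function.Injective ν) (hμinj : Function.Injective μ)
    (hsep : DotGroup.RecursivelyInseparable (Set.range ν) (Set.range μ))
    -- the finitely generated torsion-free group with decidable word problem
    {Gdd : Type*} [Group Gdd] (k : ℕ) (s : Fin k → Gdd)
    (hgen : Subgroup.closure (Set.range s) = ⊤)
    (hwp : DotGroup.WordProblemDecidable s)
    (htf : DotGroup.TorsionFree Gdd)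
    -- the embedding, with computable images of the generators
    (Φ : DotGroup.GDot ν μ →* Gdd) (hΦ : Function.Injective Φ)
    (ha : DotGroup.ComputableInto s
      (fun p : ℕ+ × Fin 2 => Φ (DotGroup.aDot ν μ p.1 p.2)))
    (hb : DotGroup.ComputableInto s
      (fun p : ℕ+ × Fin 2 => Φ (DotGroup.bDot ν μ p.1 p.2)))
    (ht : DotGroup.ComputableInto s (fun i : ℕ+ => Φ (DotGroup.tDot ν μ i)))
    -- the group with decidable conjugacy problem
    {Gbar : Type*} [Group Gbar] (hcp : DotGroup.HasDecidableConjugacyProblem Gbar) :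
    ¬ ∃ Ψ : Gdd →* Gbar, Function.Injective Ψ := by
  rintro ⟨Ψ, hΨ⟩
  obtain ⟨ι, _, x, hx, hconj⟩ := hcp
  have hword := hconj.wordProblemDecidable
  obtain ⟨A, hA, hAval⟩ := ha.map hx Ψ
  obtain ⟨B, hB, hBval⟩ := hb.map hx Ψ
  have hfst (m : Fin 2) : Computable fun p : ℕ+ × DotGroup.Word ι => (p.1, m) :=
    Computable.pair Computable.fst (Computable.const m)
  have hQ : ComputablePred fun n : ℕ+ =>
      IsConj (DotGroup.wordVal x (A (n, 0))) (DotGroup.wordVal x (B (n, 0))) :=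
    hconj.preimage (f := fun n : ℕ+ => (A (n, 0), B (n, 0))) <| Computable.pair
      (hA.comp (Computable.pair Computable.id (Computable.const 0)))
      (hB.comp (Computable.pair Computable.id (Computable.const 0)))
  have hR (m : Fin 2) : ComputablePred fun p : ℕ+ × DotGroup.Word ι =>
      DotGroup.wordVal x (p.2 ++ A (p.1, m)) = DotGroup.wordVal x (B (p.1, m) ++ p.2) :=
    hword.preimage (f := fun p : ℕ+ × DotGroup.Word ι => (p.2 ++ A (p.1, m), B (p.1, m) ++ p.2)) <|
      Computable.pair (Computable.list_append.comp Computable.snd (hA.comp (hfst m)))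
        (Computable.list_append.comp (hB.comp (hfst m)) Computable.snd)
  -- Conjugacy is written as `w a = b w`, an equation between words that the word problem of `Gbar`
  -- decides.
  obtain ⟨C, hC, hCconj⟩ := DotGroup.exists_computable_choice
    (R := fun n w => DotGroup.wordVal x (w ++ A (n, 0)) = DotGroup.wordVal x (B (n, 0) ++ w))
    hQ (hR 0) fun n hn => by
      obtain ⟨g, hg⟩ := isConj_iff.1 hn
      obtain ⟨w, rfl⟩ := DotGroup.exists_wordVal_eq hx g
      exact ⟨w, by rw [DotGroup.wordVal_append, DotGroup.wordVal_append, ← hg,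
        inv_mul_cancel_right]⟩
  have hS (m : Fin 2) := (hR m).preimage (f := fun n => (n, C n)) (Computable.pair Computable.id hC)
  simp only [DotGroup.wordVal_append, hAval, hBval] at hS hCconj
  -- The case `m = 0` has to be tested as well: `C n` is an arbitrary word when the first pair is
  -- not conjugate.
  refine hsep.2 ⟨{n | ∀ m : Fin 2, DotGroup.wordVal x (C n) * Ψ (Φ (DotGroup.aDot ν μ n m)) =
    Ψ (Φ (DotGroup.bDot ν μ n m)) * DotGroup.wordVal x (C n)}, ?_, ?_, ?_⟩
  · obtain ⟨f₀, hf₀, hf₀'⟩ := ComputablePred.computable_iff.1 (hS 0)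
    obtain ⟨f₁, hf₁, hf₁'⟩ := ComputablePred.computable_iff.1 (hS 1)
    refine ComputablePred.computable_iff.2 ⟨_, Primrec.and.to_comp.comp hf₀ hf₁, ?_⟩
    funext n
    have h₀ := congrFun hf₀' n
    have h₁ := congrFun hf₁' n
    simp only [Set.mem_ofPred_eq, Fin.forall_fin_two, Bool.and_eq_true] at h₀ h₁ ⊢
    rw [h₀, h₁]
  · rintro _ ⟨i, rfl⟩
    have h₀ : SemiconjBy (DotGroup.wordVal x (C (ν i))) (Ψ (Φ (DotGroup.aDot ν μ (ν i) 0)))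
        (Ψ (Φ (DotGroup.bDot ν μ (ν i) 0))) := by
      -- The conjugator `t_i⁻¹` only shows that the search succeeds; `C (ν i)` may be a different
      -- one.
      refine hCconj (ν i) (isConj_iff.2 ⟨(Ψ (Φ (DotGroup.tDot ν μ i)))⁻¹, ?_⟩)
      rw [← DotGroup.tDot_conj i]
      simp
    refine Fin.forall_fin_two.2 ⟨h₀, ?_⟩
    rw [DotGroup.aDot_one_left, DotGroup.bDot_one (Or.inl rfl)]
    rw [map_zpow, map_zpow, map_zpow, map_zpow]
    exact h₀.zpow_right _
  · rintro _ ⟨i, rfl⟩ h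
    have h₀ : SemiconjBy (DotGroup.wordVal x (C (μ i))) (Ψ (Φ (DotGroup.aDot ν μ (μ i) 0)))
        (Ψ (Φ (DotGroup.bDot ν μ (μ i) 0))) := h 0
    have h₁ := h 1
    -- Moving `C (μ i)` past the power of `a_{n,0}` and cancelling it leaves `b_{n,0} ^ 3 ^ i =
    -- b_{n,0} ^ 2 ^ i`, which injectivity of `Ψ` and `Φ` pulls back to `GDot ν μ`.
    rw [DotGroup.aDot_one_right, DotGroup.bDot_one (Or.inr rfl), map_zpow, map_zpow,
      (h₀.zpow_right _).eq, ← map_zpow, ← map_zpow, mul_left_inj] at h₁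
    have hpow := DotGroup.bDot_zero_zpow_injective hνinj hμinj hsep.1 (μ i) (hΦ (hΨ h₁))
    have hlt : (2 : ℤ) ^ (i : ℕ) < 3 ^ (i : ℕ) :=
      pow_lt_pow_left₀ (by norm_num) (by norm_num) i.ne_zero
    exact hlt.ne' hpow
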